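/- Corollary 3.1. Let $0<a\le\infty$, and let $I=[0,a]$ if $a<\infty$ and $I=[0,\infty)$ if $a=\infty$. Call $h:I\to\mathbb C$ complex analytic in $I$ if it is the restriction to $I$ of a function of a complex variable that is analytic at every point of $I$. For $0<\omega<a<\infty$ put $$\operatorname{PV}\!\!\int_0^a\frac{f(x)}{\omega-x}\,dx=\lim_{\varepsilon\to0^+}\Big(\int_0^{\omega-\varepsilon}\frac{f(x)}{\omega-x}\,dx+\int_{\omega+\varepsilon}^a\frac{f(x)}{\omega-x}\,dx\Big),$$ and put $\operatorname{PV}\!\int_0^\infty\frac{f(x)}{\omega-x}dx=\lim_{b\to\infty}\operatorname{PV}\!\int_0^b\frac{f(x)}{\omega-x}dx$. Let $f:I\to\mathbb C$ be complex analytic in $I$; if $a=\infty$, suppose moreover that $\operatorname{PV}\!\int_0^\infty\frac{f(x)}{\omega-x}dx$ exists for at least one $\omega>0$. Then $\operatorname{PV}\!\int_0^a\frac{f(x)}{\omega-x}dx$ exists for every $\omega\in(0,a)$, and the following hold. 1. If $f(0)\ne0$, then $$\operatorname{PV}\!\!\int_0^a\frac{f(x)}{\omega-x}\,dx\sim f(0)\ln\omega\qquad(\omega\to0^+).$$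 2. If $f$ has a zero of order $m\ge1$ at the origin, that is, $f(x)=x^mg(x)$ on $I$ with $g$ complex analytic in $I$ and $g(0)\neq0$, then the integral $\int_0^a x^{m-1}g(x)\,dx$ converges (for $a=\infty$ as the improper integral $\lim_{b\to\infty}\int_0^b x^{m-1}g(x)\,dx$), and if it is nonzero, then $$\operatorname{PV}\!\!\int_0^a\frac{f(x)}{\omega-x}\,dx\sim-\int_0^a x^{m-1}g(x)\,dx\qquad(\omega\to0^+).$$ Here $u\sim v$ means $u-v=o(v)$. -/

import Mathlib

open Set Filter Topology Asymptotics

/-- `f`, a function of a real variable, is complex analytic in the set `s` (an interval): on `s` it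
is the restriction of a function `F` of a complex variable that is analytic at every point of `s`
(hence on a complex neighbourhood of `s`). -/
def ComplexAnalyticIn (f : ℝ → ℂ) (s : Set ℝ) : Prop :=
  ∃ F : ℂ → ℂ, AnalyticOnNhd ℂ F ((fun x : ℝ => (x : ℂ)) '' s) ∧ ∀ x ∈ s, f x = F (x : ℂ)

/-- The Cauchy principal value `PV ∫₀ᵃ f(x) / (ω - x) dx`, for `0 < ω < a < ∞`, exists and equals
`v`: the integrals over `[0, ω - ε]` and `[ω + ε, a]` together tend to `v` as `ε → 0⁺`.
(It is used for `f` continuous on `[0, a]`, so that both integrands are integrable once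
`ε` is small.) -/
def HasPV (f : ℝ → ℂ) (a ω : ℝ) (v : ℂ) : Prop :=
  Tendsto
    (fun ε : ℝ => (∫ x in (0 : ℝ)..(ω - ε), f x / ((ω : ℂ) - (x : ℂ))) +
      ∫ x in (ω + ε)..a, f x / ((ω : ℂ) - (x : ℂ)))
    (𝓝[>] 0) (𝓝 v)

/-- The Cauchy principal value `PV ∫₀^∞ f(x) / (ω - x) dx`, for `ω > 0`, exists and equals `v`:
it is the limit of the principal values over `[0, b]` as `b → ∞`. -/
def HasPVTop (f : ℝ → ℂ) (ω : ℝ) (v : ℂ) : Prop :=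
  ∃ V : ℝ → ℂ, (∀ b : ℝ, ω < b → HasPV f b ω (V b)) ∧ Tendsto V atTop (𝓝 v)

/-! For `f` Lipschitz on `[0, a]`, write `f x / (ω - x) = f ω / (ω - x) - slope f ω x`. The first
term integrates to `f ω * (log ω - log (a - ω))`, since the singularities at `ω ± ε` cancel, and the
slopes are bounded; so the principal value over `[0, a]` is `f 0 * log ω + O(1)` as `ω → 0⁺`. If
`f x = x * h x`, then `f x / (ω - x) = ω * (h x / (ω - x)) - h x`, and the first term contributes
`O(ω log ω)`, which leaves `-∫ h`.

Over `[0, ∞)`, the tail `∫_c^∞ f x / (ω - x)` is obtained from the one at a fixed `ω₀` by inserting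
the weight `(ω₀ - x) / (ω - x)`. This weight tends to `1` and has an integrable derivative, so
Dirichlet's test gives convergence for every `ω < c`, with a value continuous up to `ω = 0`. For
`f x = x * h x`, the tail at `ω = 0` is `-∫_c^∞ h`, whence the convergence of `∫₀^∞ h`. -/

open MeasureTheory

section Slope

variable {E : Type*} [NormedAddCommGroup E] [NormedSpace ℝ E] {f : ℝ → E} {s : Set ℝ} {K : NNReal}
  {x y : ℝ}

lemma norm_slope_le_of_lipschitzOnWith (hf : LipschitzOnWith K f s) (hx : x ∈ s) (hy : y ∈ s) :
    ‖slope f x y‖ ≤ K := by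
  rw [slope_def_module, norm_smul, norm_inv]
  exact inv_mul_le_of_le_mul₀ (norm_nonneg _) K.2 (mul_comm (K : ℝ) _ ▸ hf.norm_sub_le hy hx)

lemma integrableOn_slope_of_lipschitzOnWith (hf : LipschitzOnWith K f s) (hs : MeasurableSet s)
    (hs' : volume s ≠ ⊤) (hx : x ∈ s) : IntegrableOn (slope f x) s := by
  have hfm : AEStronglyMeasurable f (volume.restrict s) := hf.continuousOn.aestronglyMeasurable hs
  have hmeas : AEStronglyMeasurable (slope f x) (volume.restrict s) := by
    rw [slope_fun_def]
    exact (measurable_id.sub_const x).inv.aestronglyMeasurable.smul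
      (hfm.sub aestronglyMeasurable_const)
  refine IntegrableOn.of_bound hs'.lt_top hmeas K ?_
  filter_upwards [ae_restrict_mem hs] with y hy
  exact norm_slope_le_of_lipschitzOnWith hf hx hy

end Slope

section Punctured

variable {E : Type*} [NormedAddCommGroup E] [NormedSpace ℝ E]

lemma tendsto_integral_add_integral_nhdsGT_zero {φ : ℝ → E} {a b ω : ℝ}
    (hφ : IntervalIntegrable φ volume a b) (hω : ω ∈ Ioo a b) :
    Tendsto (fun ε : ℝ => (∫ x in a..ω - ε, φ x) + ∫ x in ω + ε..b, φ x) (𝓝[>] 0)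
      (𝓝 (∫ x in a..b, φ x)) := by
  have hab : a ≤ b := (hω.1.trans hω.2).le
  set G : ℝ → E := fun t => ∫ x in a..t, φ x with hG
  have hGω : ContinuousAt G ω := by
    have hGc := intervalIntegral.continuousOn_primitive_interval' hφ left_mem_uIcc
    rw [uIcc_of_le hab] at hGc
    exact hGc.continuousAt (Icc_mem_nhds hω.1 hω.2)
  have hlim : Tendsto (fun ε : ℝ => G (ω - ε) + (G b - G (ω + ε))) (𝓝[>] 0) (𝓝 (G b)) := by
    have hc : ContinuousAt (fun ε : ℝ => G (ω - ε) + (G b - G (ω + ε))) 0 :=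
      (hGω.comp_of_eq (by fun_prop) (sub_zero ω)).add
        (continuousAt_const.sub (hGω.comp_of_eq (by fun_prop) (add_zero ω)))
    simpa using hc.tendsto.mono_left nhdsWithin_le_nhds
  refine hlim.congr' ?_
  filter_upwards [Ioo_mem_nhdsGT (sub_pos.2 hω.2)] with ε hε
  have hmem : ω + ε ∈ uIcc a b := by
    rw [uIcc_of_le hab]
    exact ⟨by linarith [hω.1, hε.1], by linarith [hε.2]⟩
  rw [hG, intervalIntegral.integral_interval_sub_left hφ
    (hφ.mono_set (uIcc_subset_uIcc_left hmem))]

end Punctured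

section FiniteInterval

variable {f h : ℝ → ℂ} {a ω : ℝ} {K : NNReal}

/-- The value of `PV ∫₀ᵃ f(x) / (ω - x) dx` for `f` Lipschitz on `[0, a]` and `0 < ω < a`, obtained
by writing `f x = f ω + (x - ω) * slope f ω x`. -/
noncomputable def pvIntegral (f : ℝ → ℂ) (a ω : ℝ) : ℂ :=
  f ω * ((Real.log ω - Real.log (a - ω) : ℝ) : ℂ) - ∫ x in (0 : ℝ)..a, slope f ω x

lemma div_sub_eq_sub_slope (f : ℝ → ℂ) (ω x : ℝ) :
    f x / ((ω : ℂ) - x) = f ω * (((ω - x)⁻¹ : ℝ) : ℂ) - slope f ω x := by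
  rw [slope_def_module, Complex.real_smul, ← neg_sub ω x, inv_neg]
  push_cast
  ring

lemma integral_div_sub_eq {p q : ℝ} (hf : IntervalIntegrable (slope f ω) volume p q)
    (hω : ω ∉ uIcc p q) :
    ∫ x in p..q, f x / ((ω : ℂ) - x) =
      f ω * ((Real.log ((ω - p) / (ω - q)) : ℝ) : ℂ) - ∫ x in p..q, slope f ω x := by
  have hne : ∀ x ∈ uIcc p q, ω - x ≠ 0 := fun x hx h => hω (sub_eq_zero.1 h ▸ hx)
  have h0 : (0 : ℝ) ∉ uIcc (ω - q) (ω - p) := by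
    rw [uIcc_comm, ← image_const_sub_uIcc]
    rintro ⟨x, hx, h⟩
    exact hne x hx h
  have hinv : IntervalIntegrable (fun x => (((ω - x)⁻¹ : ℝ) : ℂ)) volume p q :=
    (Complex.continuous_ofReal.comp_continuousOn
      ((continuousOn_const.sub continuousOn_id).inv₀ hne)).intervalIntegrable
  simp only [div_sub_eq_sub_slope]
  rw [intervalIntegral.integral_sub (hinv.const_mul _) hf, intervalIntegral.integral_const_mul,
    intervalIntegral.integral_ofReal, intervalIntegral.integral_comp_sub_left (fun x => x⁻¹),
    integral_inv h0]

lemma intervalIntegrable_slope_of_lipschitzOnWith (hf : LipschitzOnWith K f (Icc 0 a))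
    (hω : ω ∈ Icc 0 a) : IntervalIntegrable (slope f ω) volume 0 a :=
  (intervalIntegrable_iff_integrableOn_Icc_of_le (hω.1.trans hω.2)).2
    (integrableOn_slope_of_lipschitzOnWith hf measurableSet_Icc measure_Icc_lt_top.ne hω)

lemma hasPV_pvIntegral (hf : LipschitzOnWith K f (Icc 0 a)) (hω : ω ∈ Ioo 0 a) :
    HasPV f a ω (pvIntegral f a ω) := by
  have hint := intervalIntegrable_slope_of_lipschitzOnWith hf (Ioo_subset_Icc_self hω)
  obtain ⟨h0, ha⟩ := hω
  refine ((tendsto_integral_add_integral_nhdsGT_zero hint ⟨h0, ha⟩).const_sub _).congr' ?_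
  filter_upwards [Ioo_mem_nhdsGT (lt_min h0 (sub_pos.2 ha))] with ε ⟨hε, hε'⟩
  obtain ⟨hεω, hεa⟩ := lt_min_iff.1 hε'
  have hleft : uIcc 0 (ω - ε) = Icc 0 (ω - ε) := uIcc_of_le (by linarith)
  have hright : uIcc (ω + ε) a = Icc (ω + ε) a := uIcc_of_le (by linarith)
  have hwhole : uIcc 0 a = Icc 0 a := uIcc_of_le (h0.trans ha).le
  have hlogl : Real.log ((ω - 0) / (ω - (ω - ε))) = Real.log ω - Real.log ε := by
    rw [sub_zero, sub_sub_cancel, Real.log_div h0.ne' hε.ne']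
  have hlogr : Real.log ((ω - (ω + ε)) / (ω - a)) = Real.log ε - Real.log (a - ω) := by
    rw [sub_add_cancel_left, ← neg_sub a ω, neg_div_neg_eq,
      Real.log_div hε.ne' (sub_pos.2 ha).ne']
  rw [integral_div_sub_eq (hint.mono_set ?_) (by grind),
    integral_div_sub_eq (hint.mono_set ?_) (by grind), hlogl, hlogr]
  · push_cast
    ring
  · rw [hright, hwhole]
    exact Icc_subset_Icc_left (by linarith)
  · rw [hleft, hwhole]
    exact Icc_subset_Icc_right (by linarith)

lemma HasPV.unique {v w : ℂ} (hv : HasPV f a ω v) (hw : HasPV f a ω w) : v = w :=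
  tendsto_nhds_unique hv hw

lemma integral_div_sub_eq_of_eq_mul {p q : ℝ} (hh : ContinuousOn h (uIcc p q))
    (hfh : ∀ x ∈ uIcc p q, f x = x * h x) (hω : ω ∉ uIcc p q) :
    ∫ x in p..q, f x / ((ω : ℂ) - x) =
      ω * (∫ x in p..q, h x / ((ω : ℂ) - x)) - ∫ x in p..q, h x := by
  have hne : ∀ x ∈ uIcc p q, (ω : ℂ) - x ≠ 0 := fun x hx h =>
    hω (Complex.ofReal_inj.1 (sub_eq_zero.1 h) ▸ hx)
  have hdiv : IntervalIntegrable (fun x : ℝ => h x / ((ω : ℂ) - x)) volume p q :=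
    (hh.div (by fun_prop) hne).intervalIntegrable
  rw [← intervalIntegral.integral_const_mul,
    ← intervalIntegral.integral_sub (hdiv.const_mul _) hh.intervalIntegrable]
  refine intervalIntegral.integral_congr fun x hx => ?_
  have hωx := hne x hx
  simp only [hfh x hx]
  field_simp
  ring

lemma HasPV.of_eq_mul {v : ℂ} (hv : HasPV h a ω v) (hω : ω ∈ Ioo 0 a)
    (hh : ContinuousOn h (Icc 0 a)) (hfh : ∀ x ∈ Icc 0 a, f x = x * h x) :
    HasPV f a ω (ω * v - ∫ x in (0 : ℝ)..a, h x) := by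
  obtain ⟨h0, ha⟩ := hω
  have hint : IntervalIntegrable h volume 0 a :=
    ContinuousOn.intervalIntegrable_of_Icc (h0.trans ha).le hh
  have hsplit : ∀ p ∈ Icc 0 a, ∀ q ∈ Icc 0 a, ω ∉ uIcc p q → ∫ x in p..q, f x / ((ω : ℂ) - x) =
      ω * (∫ x in p..q, h x / ((ω : ℂ) - x)) - ∫ x in p..q, h x := fun p hp q hq =>
    integral_div_sub_eq_of_eq_mul (hh.mono (uIcc_subset_Icc hp hq))
      fun x hx => hfh x (uIcc_subset_Icc hp hq hx)
  refine ((hv.const_mul _).sub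
    (tendsto_integral_add_integral_nhdsGT_zero hint ⟨h0, ha⟩)).congr' ?_
  filter_upwards [Ioo_mem_nhdsGT (lt_min h0 (sub_pos.2 ha))] with ε ⟨hε, hε'⟩
  obtain ⟨hεω, hεa⟩ := lt_min_iff.1 hε'
  rw [hsplit 0 (by grind) (ω - ε) (by grind) (by grind [uIcc_of_le]),
    hsplit (ω + ε) (by grind) a (by grind) (by grind [uIcc_of_le])]
  ring

lemma pvIntegral_sub_mul_log_isBigO_one (ha : 0 < a) (hf : LipschitzOnWith K f (Icc 0 a)) :
    (fun ω => pvIntegral f a ω - f 0 * ((Real.log ω : ℝ) : ℂ)) =O[𝓝[>] 0]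
      (fun _ => (1 : ℝ)) := by
  have h0 : (0 : ℝ) ∈ Icc 0 a := left_mem_Icc.2 ha.le
  have hslope : (fun ω => ∫ x in (0 : ℝ)..a, slope f ω x) =O[𝓝[>] 0] (fun _ => (1 : ℝ)) := by
    refine IsBigO.of_bound (K * |a - 0|) ?_
    filter_upwards [Ioo_mem_nhdsGT ha] with ω hω
    rw [norm_one, mul_one]
    refine intervalIntegral.norm_integral_le_of_norm_le_const fun x hx => ?_
    rw [uIoc_of_le ha.le] at hx
    exact norm_slope_le_of_lipschitzOnWith hf (Ioo_subset_Icc_self hω) (Ioc_subset_Icc_self hx)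
  have hlog : (fun ω => (f ω - f 0) * ((Real.log ω : ℝ) : ℂ)) =O[𝓝[>] 0] (fun _ => (1 : ℝ)) := by
    have hsub : (fun ω => f ω - f 0) =O[𝓝[>] 0] (fun ω : ℝ => ω) := by
      refine IsBigO.of_bound K ?_
      filter_upwards [Ioo_mem_nhdsGT ha] with ω hω
      simpa using hf.norm_sub_le (Ioo_subset_Icc_self hω) h0
    have hxlog : (fun ω : ℝ => ω * Real.log ω) =O[𝓝[>] 0] (fun _ => (1 : ℝ)) :=
      ((Real.continuous_mul_log.tendsto 0).mono_left nhdsWithin_le_nhds).isBigO_one ℝ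
    exact (hsub.mul (Complex.isBigO_ofReal_left.2 (isBigO_refl Real.log _))).trans hxlog
  have hfa : (fun ω => f ω * ((Real.log (a - ω) : ℝ) : ℂ)) =O[𝓝[>] 0] (fun _ => (1 : ℝ)) := by
    have hf0 : Tendsto f (𝓝[>] 0) (𝓝 (f 0)) :=
      (hf.continuousOn 0 h0).mono_left (nhdsWithin_le_of_mem (Icc_mem_nhdsGT ha))
    have hlog0 : ContinuousAt (fun ω : ℝ => ((Real.log (a - ω) : ℝ) : ℂ)) 0 :=
      Complex.continuous_ofReal.continuousAt.comp
        (ContinuousAt.log (by fun_prop) (by simpa using ha.ne'))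
    exact (hf0.mul (hlog0.tendsto.mono_left nhdsWithin_le_nhds)).isBigO_one ℝ
  refine ((hlog.sub hslope).sub hfa).congr_left fun ω => ?_
  simp only [pvIntegral]
  push_cast
  ring

lemma one_isLittleO_log_nhdsGT_zero :
    (fun _ : ℝ => (1 : ℝ)) =o[𝓝[>] 0] (fun ω : ℝ => ((Real.log ω : ℝ) : ℂ)) :=
  isLittleO_const_left.2 <| .inr <| by
    simpa [Function.comp_def] using tendsto_abs_atBot_atTop.comp Real.tendsto_log_nhdsGT_zero

lemma pvIntegral_add_isEquivalent (ha : 0 < a) (hf : LipschitzOnWith K f (Icc 0 a)) (h0 : f 0 ≠ 0)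
    {T : ℝ → ℂ} (hT : T =O[𝓝[>] 0] (fun _ => (1 : ℝ))) :
    (fun ω => pvIntegral f a ω + T ω) ~[𝓝[>] 0]
      (fun ω : ℝ => f 0 * ((Real.log ω : ℝ) : ℂ)) := by
  refine (((pvIntegral_sub_mul_log_isBigO_one ha hf).add hT).trans_isLittleO
    (one_isLittleO_log_nhdsGT_zero.const_mul_right h0)).congr_left fun ω => ?_
  simp only [Pi.sub_apply]
  ring

lemma tendsto_mul_pvIntegral (ha : 0 < a) (hf : LipschitzOnWith K f (Icc 0 a)) :
    Tendsto (fun ω : ℝ => ω * pvIntegral f a ω) (𝓝[>] 0) (𝓝 0) := by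
  have hid : (fun ω : ℝ => (ω : ℂ)) =o[𝓝[>] 0] (fun _ => (1 : ℝ)) :=
    (isLittleO_one_iff ℝ).2 <| by
      simpa using (Complex.continuous_ofReal.tendsto 0).mono_left nhdsWithin_le_nhds
  have hrem : Tendsto (fun ω : ℝ => ω * (pvIntegral f a ω - f 0 * ((Real.log ω : ℝ) : ℂ)))
      (𝓝[>] 0) (𝓝 0) := by
    simpa [isLittleO_one_iff] using hid.mul_isBigO (pvIntegral_sub_mul_log_isBigO_one ha hf)
  have hlog : Tendsto (fun ω : ℝ => f 0 * ((ω * Real.log ω : ℝ) : ℂ)) (𝓝[>] 0) (𝓝 0) := by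
    have hc : Continuous fun ω : ℝ => f 0 * ((ω * Real.log ω : ℝ) : ℂ) :=
      continuous_const.mul (Complex.continuous_ofReal.comp Real.continuous_mul_log)
    simpa using (hc.tendsto 0).mono_left nhdsWithin_le_nhds
  refine (add_zero (0 : ℂ) ▸ hrem.add hlog).congr fun ω => ?_
  push_cast
  ring

end FiniteInterval

section Dirichlet

variable {E : Type*} [NormedAddCommGroup E]

lemma exists_norm_le_of_tendsto_atTop {U : ℝ → E} {c : ℝ} {l : E} (hU : ContinuousOn U (Ici c))
    (hl : Tendsto U atTop (𝓝 l)) : ∃ K : ℝ, ∀ x ∈ Ici c, ‖U x‖ ≤ K := by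
  obtain ⟨B, hB⟩ := eventually_atTop.1 (hl.norm.eventually_lt_const (lt_add_one _))
  obtain ⟨M, hM⟩ := isCompact_Icc.exists_bound_of_continuousOn
    (hU.mono (Icc_subset_Ici_self : Icc c B ⊆ Ici c))
  refine ⟨max M (‖l‖ + 1), fun x hx => ?_⟩
  rcases le_total x B with h | h
  · exact (hM x ⟨hx, h⟩).trans (le_max_left _ _)
  · exact (hB x h).le.trans (le_max_right _ _)

variable [NormedSpace ℝ E] {φ : ℝ → E} {c : ℝ} {l : E}

lemma continuousOn_primitive_Ici (hφ : ContinuousOn φ (Ici c)) :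
    ContinuousOn (fun x => ∫ t in c..x, φ t) (Ici c) := by
  intro x (hx : c ≤ x)
  have hcx : uIcc c (x + 1) = Icc c (x + 1) := uIcc_of_le (by linarith)
  have hint : IntegrableOn φ (uIcc c (x + 1)) :=
    hcx ▸ (hφ.mono Icc_subset_Ici_self).integrableOn_Icc
  have hcont := intervalIntegral.continuousOn_primitive_interval hint
  rw [hcx] at hcont
  exact (hcont x ⟨hx, by linarith⟩).mono_of_mem_nhdsWithin
    (inter_mem_nhdsWithin _ (Iic_mem_nhds (lt_add_one x)))

lemma hasDerivAt_primitive_Ici [CompleteSpace E] (hφ : ContinuousOn φ (Ici c)) {x : ℝ}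
    (hx : c < x) : HasDerivAt (fun x => ∫ t in c..x, φ t) (φ x) x :=
  intervalIntegral.integral_hasDerivAt_right
    (hφ.mono (uIcc_of_le hx.le ▸ Icc_subset_Ici_self)).intervalIntegrable
    ((hφ.mono Ioi_subset_Ici_self).stronglyMeasurableAtFilter isOpen_Ioi x hx)
    (hφ.continuousAt (Ici_mem_nhds hx))

lemma tendsto_integral_smul_of_tendsto_integral [CompleteSpace E] {w w' : ℝ → ℝ} {w₀ : ℝ}
    (hw : ∀ x ∈ Ici c, HasDerivAt w (w' x) x) (hw' : IntegrableOn w' (Ioi c))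
    (hw₀ : Tendsto w atTop (𝓝 w₀)) (hφ : ContinuousOn φ (Ici c))
    (hl : Tendsto (fun b => ∫ x in c..b, φ x) atTop (𝓝 l)) :
    Tendsto (fun b => ∫ x in c..b, w x • φ x) atTop
      (𝓝 (w₀ • l - ∫ x in Ioi c, w' x • ∫ t in c..x, φ t)) := by
  have hU := continuousOn_primitive_Ici hφ
  obtain ⟨K, hK⟩ := exists_norm_le_of_tendsto_atTop hU hl
  have hint : IntegrableOn (fun x => w' x • ∫ t in c..x, φ t) (Ioi c) := by
    refine hw'.smul_bdd K
      ((hU.mono Ioi_subset_Ici_self).aestronglyMeasurable measurableSet_Ioi) ?_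
    filter_upwards [ae_restrict_mem measurableSet_Ioi] with x (hx : c < x)
    exact hK x hx.le
  refine ((hw₀.smul hl).sub
    (intervalIntegral_tendsto_integral_Ioi c hint tendsto_id)).congr' ?_
  filter_upwards [eventually_ge_atTop c] with b hb
  have hsub : uIcc c b ⊆ Ici c := uIcc_of_le hb ▸ Icc_subset_Ici_self
  have hlt : ∀ x ∈ Ioo (min c b) (max c b), c < x := fun x hx => min_eq_left hb ▸ hx.1
  have hparts := intervalIntegral.integral_smul_deriv_eq_deriv_smul_of_hasDerivAt
    (fun x hx => (hw x (hsub hx)).continuousAt.continuousWithinAt) (hU.mono hsub)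
    (fun x hx => hw x (hlt x hx).le) (fun x hx => hasDerivAt_primitive_Ici hφ (hlt x hx))
    ((intervalIntegrable_iff_integrableOn_Ioc_of_le hb).2 (hw'.mono_set Ioc_subset_Ioi_self))
    (hφ.mono hsub).intervalIntegrable
  simpa using hparts.symm

lemma integrableOn_inv_sub_sq {ω : ℝ} (h : ω < c) :
    IntegrableOn (fun x : ℝ => ((x - ω) ^ 2)⁻¹) (Ioi c) := by
  refine (integrableOn_add_rpow_Ioi_of_lt (a := -2) (m := -ω) (by norm_num)
    (by simpa using h)).congr_fun (fun x (hx : c < x) => ?_) measurableSet_Ioi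
  have hx' : 0 ≤ x + -ω := by linarith
  simp only [Real.rpow_neg hx', Real.rpow_two, sub_eq_add_neg]

lemma continuousOn_integral_inv_sub_sq_smul {U : ℝ → E} {K : ℝ} (hU : ContinuousOn U (Ici c))
    (hK : ∀ x ∈ Ici c, ‖U x‖ ≤ K) :
    ContinuousOn (fun ω => ∫ x in Ioi c, ((x - ω) ^ 2)⁻¹ • U x) (Iio c) := by
  intro ω₁ (hω₁ : ω₁ < c)
  obtain ⟨δ, hωδ, hδ⟩ := exists_between hω₁
  have hUm := (hU.mono Ioi_subset_Ici_self).aestronglyMeasurable (μ := volume) measurableSet_Ioi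
  refine (continuousAt_of_dominated (bound := fun x => ((x - δ) ^ 2)⁻¹ * K) (.of_forall fun ω => ?_)
    ?_ ((integrableOn_inv_sub_sq hδ).mul_const K) ?_).continuousWithinAt
  · exact ((measurable_id.sub_const ω).pow_const 2).inv.aestronglyMeasurable.smul hUm
  · filter_upwards [eventually_lt_nhds hωδ] with ω hω
    filter_upwards [ae_restrict_mem measurableSet_Ioi] with x (hx : c < x)
    rw [norm_smul, Real.norm_of_nonneg (by positivity)]
    have hδx : 0 < x - δ := by linarith
    gcongr
    exact hK x hx.le
  · filter_upwards [ae_restrict_mem measurableSet_Ioi] with x (hx : c < x)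
    have hne : x - ω₁ ≠ 0 := (sub_pos.2 (hω₁.trans hx)).ne'
    have hsub : ContinuousAt (fun ω => (x - ω) ^ 2) ω₁ := by fun_prop
    exact (hsub.inv₀ (pow_ne_zero 2 hne)).smul continuousAt_const

end Dirichlet

section InfiniteInterval

variable {f h : ℝ → ℂ} {ω ω₀ c b : ℝ} {v t : ℂ}

lemma hasDerivAt_sub_div_sub {x : ℝ} (hx : ω ≠ x) :
    HasDerivAt (fun x => (ω₀ - x) / (ω - x)) ((ω₀ - ω) * ((x - ω) ^ 2)⁻¹) x := by
  refine (((hasDerivAt_id x).const_sub ω₀).fun_div ((hasDerivAt_id x).const_sub ω)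
    (sub_ne_zero.2 hx)).congr_deriv ?_
  have h₁ := sub_ne_zero.2 hx
  have h₂ := sub_ne_zero.2 hx.symm
  simp only [id]
  field_simp
  ring

lemma tendsto_sub_div_sub_atTop (ω₀ ω : ℝ) :
    Tendsto (fun x => (ω₀ - x) / (ω - x)) atTop (𝓝 1) := by
  have hinv : Tendsto (fun x : ℝ => (ω - x)⁻¹) atTop (𝓝 0) :=
    tendsto_inv_atBot_zero.comp (tendsto_const_nhds.add_atBot tendsto_neg_atTop_atBot)
  have hlim := (hinv.const_mul (ω₀ - ω)).const_add 1
  rw [mul_zero, add_zero] at hlim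
  refine hlim.congr' ?_
  filter_upwards [eventually_gt_atTop ω] with x hx
  have hωx : ω - x ≠ 0 := (sub_neg.2 hx).ne
  field_simp
  ring

lemma continuousOn_div_sub (hf : ContinuousOn f (Ioi ω)) :
    ContinuousOn (fun x : ℝ => f x / ((ω : ℂ) - x)) (Ioi ω) :=
  hf.div (by fun_prop) fun _ (hx : ω < _) => sub_ne_zero.2 (Complex.ofReal_injective.ne hx.ne)

lemma exists_continuousOn_tendsto_integral_div_sub (hf : ContinuousOn f (Ici c)) (hω₀ : ω₀ < c)
    (ht : Tendsto (fun b => ∫ x in c..b, f x / ((ω₀ : ℂ) - x)) atTop (𝓝 t)) :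
    ∃ T : ℝ → ℂ, ContinuousOn T (Iio c) ∧
      ∀ ω < c, Tendsto (fun b => ∫ x in c..b, f x / ((ω : ℂ) - x)) atTop (𝓝 (T ω)) := by
  have hne : ∀ {ω x : ℝ}, ω < x → (ω : ℂ) - x ≠ 0 := fun h =>
    sub_ne_zero.2 (Complex.ofReal_injective.ne h.ne)
  have hφ : ContinuousOn (fun x : ℝ => f x / ((ω₀ : ℂ) - x)) (Ici c) :=
    hf.div (by fun_prop) fun x hx => hne (hω₀.trans_le hx)
  have hU := continuousOn_primitive_Ici hφ
  obtain ⟨K, hK⟩ := exists_norm_le_of_tendsto_atTop hU ht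
  refine ⟨fun ω => t - (ω₀ - ω) • ∫ x in Ioi c, ((x - ω) ^ 2)⁻¹ •
    ∫ y in c..x, f y / ((ω₀ : ℂ) - y), continuousOn_const.sub
      ((continuous_const.sub continuous_id).continuousOn.smul
        (continuousOn_integral_inv_sub_sq_smul hU hK)), fun ω hω => ?_⟩
  have hlim := tendsto_integral_smul_of_tendsto_integral
    (fun x hx => hasDerivAt_sub_div_sub (ω₀ := ω₀) (hω.trans_le hx).ne)
    ((integrableOn_inv_sub_sq hω).const_mul (ω₀ - ω)) (tendsto_sub_div_sub_atTop ω₀ ω) hφ ht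
  simp only [one_smul, mul_smul, integral_smul] at hlim
  refine hlim.congr' ?_
  filter_upwards [eventually_ge_atTop c] with b hb
  refine intervalIntegral.integral_congr fun x hx => ?_
  rw [uIcc_of_le hb] at hx
  have hωx := hne (hω.trans_le hx.1)
  have hω₀x := hne (hω₀.trans_le hx.1)
  simp only [Complex.real_smul]
  push_cast
  field_simp

lemma HasPV.add_integral (hv : HasPV f c ω v) (hf : ContinuousOn f (Ioi ω)) (hc : ω < c)
    (hb : ω < b) : HasPV f b ω (v + ∫ x in c..b, f x / ((ω : ℂ) - x)) := by
  have hint : ∀ {p q : ℝ}, ω < p → ω < q →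
      IntervalIntegrable (fun x : ℝ => f x / ((ω : ℂ) - x)) volume p q := fun hp hq =>
    ((continuousOn_div_sub hf).mono (ordConnected_Ioi.uIcc_subset hp hq)).intervalIntegrable
  refine (Tendsto.add_const (∫ x in c..b, f x / ((ω : ℂ) - x)) hv).congr' ?_
  filter_upwards [self_mem_nhdsWithin] with ε hε
  have hωε : ω < ω + ε := lt_add_of_pos_right _ hε
  rw [add_assoc, intervalIntegral.integral_add_adjacent_intervals (hint hωε hc) (hint hc hb)]

lemma hasPVTop_add_iff (hv : HasPV f c ω v) (hf : ContinuousOn f (Ioi ω)) (hc : ω < c) :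
    HasPVTop f ω (v + t) ↔
      Tendsto (fun b => ∫ x in c..b, f x / ((ω : ℂ) - x)) atTop (𝓝 t) := by
  refine ⟨fun ⟨V, hV, hlim⟩ => ?_, fun ht => ⟨_, fun b hb => hv.add_integral hf hc hb,
    ht.const_add v⟩⟩
  refine (add_sub_cancel_left v t ▸ hlim.sub_const v).congr' ?_
  filter_upwards [eventually_gt_atTop ω] with b hb
  rw [(hV b hb).unique (hv.add_integral hf hc hb), add_sub_cancel_left]

lemma HasPVTop.unique {w : ℂ} (hv : HasPVTop f ω v) (hw : HasPVTop f ω w) : v = w := by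
  obtain ⟨V, hV, hVlim⟩ := hv
  obtain ⟨W, hW, hWlim⟩ := hw
  refine tendsto_nhds_unique (hVlim.congr' ?_) hWlim
  filter_upwards [eventually_gt_atTop ω] with b hb
  exact (hV b hb).unique (hW b hb)

-- `A` is any formula for the principal values over `[0, c]`, and `T` is the tail over `[c, ∞)`.
lemma exists_hasPVTop_eq_add {A : ℝ → ℝ → ℂ} (hf : ContinuousOn f (Ici 0))
    (hA : ∀ c, ∀ ω ∈ Ioo 0 c, HasPV f c ω (A c ω)) (hex : ∃ ω > 0, ∃ v : ℂ, HasPVTop f ω v) :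
    ∃ (P T : ℝ → ℂ) (c : ℝ), 0 < c ∧ (∀ ω > 0, HasPVTop f ω (P ω)) ∧ ContinuousAt T 0 ∧
      Tendsto (fun b => ∫ x in c..b, f x / (((0 : ℝ) : ℂ) - x)) atTop (𝓝 (T 0)) ∧
      ∀ ω ∈ Ioo 0 c, P ω = A c ω + T ω := by
  obtain ⟨ω₀, h0, v, hv⟩ := hex
  have hfω : ∀ ω > 0, ContinuousOn f (Ioi ω) := fun ω hω =>
    hf.mono fun x hx => (hω.trans hx).le
  have htail : ∀ c > ω₀, ∃ T : ℝ → ℂ, ContinuousOn T (Iio c) ∧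
      ∀ ω < c, Tendsto (fun b => ∫ x in c..b, f x / ((ω : ℂ) - x)) atTop (𝓝 (T ω)) :=
    fun c hc => exists_continuousOn_tendsto_integral_div_sub
      (hf.mono (Ici_subset_Ici.2 (h0.trans hc).le)) hc
      ((hasPVTop_add_iff (hA c ω₀ ⟨h0, hc⟩) (hfω ω₀ h0) hc).1
        ((add_sub_cancel (A c ω₀) v).symm ▸ hv))
  have hglue : ∀ {c ω : ℝ} {t : ℂ}, ω ∈ Ioo 0 c →
      Tendsto (fun b => ∫ x in c..b, f x / ((ω : ℂ) - x)) atTop (𝓝 t) →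
      HasPVTop f ω (A c ω + t) := fun {c ω t} hω ht =>
    (hasPVTop_add_iff (hA c ω hω) (hfω ω hω.1) hω.2).2 ht
  have hall : ∀ ω > 0, ∃ p, HasPVTop f ω p := fun ω hω => by
    obtain ⟨T, -, hT⟩ := htail (max ω₀ ω + 1) (by grind)
    exact ⟨_, hglue ⟨hω, by grind⟩ (hT ω (by grind))⟩
  choose! P hP using hall
  obtain ⟨T, hTc, hT⟩ := htail (ω₀ + 1) (lt_add_one _)
  have hc : 0 < ω₀ + 1 := h0.trans (lt_add_one _)
  exact ⟨P, T, ω₀ + 1, hc, hP, hTc.continuousAt (Iio_mem_nhds hc), hT 0 hc,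
    fun ω hω => (hP ω hω.1).unique (hglue hω (hT ω hω.2))⟩

end InfiniteInterval

section LocallyLipschitz

variable {f h : ℝ → ℂ}

lemma exists_hasPV_isEquivalent_mul_log {a : ℝ} (ha : 0 < a)
    (hf : LocallyLipschitzOn (Icc 0 a) f) (h0 : f 0 ≠ 0) :
    ∃ P : ℝ → ℂ, (∀ ω ∈ Ioo 0 a, HasPV f a ω (P ω)) ∧
      P ~[𝓝[>] 0] (fun ω : ℝ => f 0 * ((Real.log ω : ℝ) : ℂ)) := by
  obtain ⟨K, hK⟩ := hf.exists_lipschitzOnWith_of_compact isCompact_Icc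
  exact ⟨pvIntegral f a, fun ω hω => hasPV_pvIntegral hK hω,
    by simpa using pvIntegral_add_isEquivalent ha hK h0 (isBigO_zero _ _)⟩

lemma exists_hasPV_isEquivalent_neg_integral {a : ℝ} (ha : 0 < a)
    (hh : LocallyLipschitzOn (Icc 0 a) h) (hfh : ∀ x ∈ Icc 0 a, f x = x * h x) :
    ∃ P : ℝ → ℂ, (∀ ω ∈ Ioo 0 a, HasPV f a ω (P ω)) ∧
      ((∫ x in (0 : ℝ)..a, h x) ≠ 0 → P ~[𝓝[>] 0] (fun _ => -∫ x in (0 : ℝ)..a, h x)) := by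
  obtain ⟨K, hK⟩ := hh.exists_lipschitzOnWith_of_compact isCompact_Icc
  refine ⟨fun ω => ω * pvIntegral h a ω - ∫ x in (0 : ℝ)..a, h x,
    fun ω hω => (hasPV_pvIntegral hK hω).of_eq_mul hω hK.continuousOn hfh, fun hL => ?_⟩
  refine (isEquivalent_const_iff_tendsto (neg_ne_zero.2 hL)).2 ?_
  simpa using (tendsto_mul_pvIntegral ha hK).sub_const (∫ x in (0 : ℝ)..a, h x)

lemma exists_hasPVTop_isEquivalent_mul_log (hf : LocallyLipschitzOn (Ici 0) f) (h0 : f 0 ≠ 0)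
    (hex : ∃ ω > 0, ∃ v : ℂ, HasPVTop f ω v) :
    ∃ P : ℝ → ℂ, (∀ ω > 0, HasPVTop f ω (P ω)) ∧
      P ~[𝓝[>] 0] (fun ω : ℝ => f 0 * ((Real.log ω : ℝ) : ℂ)) := by
  have hlip : ∀ c : ℝ, ∃ K, LipschitzOnWith K f (Icc 0 c) := fun c =>
    (hf.mono Icc_subset_Ici_self).exists_lipschitzOnWith_of_compact isCompact_Icc
  choose K hK using hlip
  obtain ⟨P, T, c, hc, hP, hT, -, hPT⟩ := exists_hasPVTop_eq_add hf.continuousOn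
    (fun c ω hω => hasPV_pvIntegral (hK c) hω) hex
  refine ⟨P, hP, (pvIntegral_add_isEquivalent hc (hK c) h0
    ((hT.tendsto.mono_left nhdsWithin_le_nhds).isBigO_one ℝ)).congr_left ?_⟩
  filter_upwards [Ioo_mem_nhdsGT hc] with ω hω using (hPT ω hω).symm

lemma tendsto_integral_of_eq_mul {c : ℝ} {t : ℂ} (hc : 0 < c) (hh : ContinuousOn h (Ici 0))
    (hfh : ∀ x ∈ Ici (0 : ℝ), f x = x * h x)
    (ht : Tendsto (fun b => ∫ x in c..b, f x / (((0 : ℝ) : ℂ) - x)) atTop (𝓝 t)) :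
    Tendsto (fun b => ∫ x in (0 : ℝ)..b, h x) atTop (𝓝 ((∫ x in (0 : ℝ)..c, h x) - t)) := by
  have hint : ∀ {p q : ℝ}, 0 ≤ p → 0 ≤ q → IntervalIntegrable h volume p q := fun hp hq =>
    (hh.mono (ordConnected_Ici.uIcc_subset hp hq)).intervalIntegrable
  refine (ht.const_sub _).congr' ?_
  filter_upwards [eventually_ge_atTop c] with b hb
  have hsub : uIcc c b ⊆ Ici c := uIcc_of_le hb ▸ Icc_subset_Ici_self
  have hmem : uIcc c b ⊆ Ici 0 := hsub.trans (Ici_subset_Ici.2 hc.le)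
  rw [integral_div_sub_eq_of_eq_mul (hh.mono hmem) (fun x hx => hfh x (hmem hx))
    fun h => hc.not_ge (hsub h), Complex.ofReal_zero, zero_mul, zero_sub, sub_neg_eq_add,
    intervalIntegral.integral_add_adjacent_intervals (hint le_rfl hc.le)
      (hint hc.le (hc.le.trans hb))]

lemma exists_hasPVTop_isEquivalent_neg_integral (hh : LocallyLipschitzOn (Ici 0) h)
    (hfh : ∀ x ∈ Ici (0 : ℝ), f x = x * h x) (hex : ∃ ω > 0, ∃ v : ℂ, HasPVTop f ω v) :
    ∃ (P : ℝ → ℂ) (L : ℂ), (∀ ω > 0, HasPVTop f ω (P ω)) ∧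
      Tendsto (fun b : ℝ => ∫ x in (0 : ℝ)..b, h x) atTop (𝓝 L) ∧
      (L ≠ 0 → P ~[𝓝[>] 0] (fun _ => -L)) := by
  have hlip : ∀ c : ℝ, ∃ K, LipschitzOnWith K h (Icc 0 c) := fun c =>
    (hh.mono Icc_subset_Ici_self).exists_lipschitzOnWith_of_compact isCompact_Icc
  choose K hK using hlip
  have hf : ContinuousOn f (Ici 0) :=
    (Complex.continuous_ofReal.continuousOn.mul hh.continuousOn).congr hfh
  obtain ⟨P, T, c, hc, hP, hT, hT0, hPT⟩ := exists_hasPVTop_eq_add hf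
    (fun c ω hω => (hasPV_pvIntegral (hK c) hω).of_eq_mul hω (hK c).continuousOn
      fun x hx => hfh x hx.1) hex
  refine ⟨P, (∫ x in (0 : ℝ)..c, h x) - T 0, hP,
    tendsto_integral_of_eq_mul hc hh.continuousOn hfh hT0, fun hL => ?_⟩
  refine (isEquivalent_const_iff_tendsto (neg_ne_zero.2 hL)).2 ?_
  rw [neg_sub, sub_eq_neg_add, ← zero_sub]
  refine (((tendsto_mul_pvIntegral hc (hK c)).sub_const _).add
    (hT.tendsto.mono_left nhdsWithin_le_nhds)).congr' ?_
  filter_upwards [Ioo_mem_nhdsGT hc] with ω hω using (hPT ω hω).symm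

theorem corollary3p1_general :
    (∀ (a : ℝ) (f : ℝ → ℂ), 0 < a → LocallyLipschitzOn (Icc 0 a) f → f 0 ≠ 0 →
      ∃ P : ℝ → ℂ, (∀ ω ∈ Ioo 0 a, HasPV f a ω (P ω)) ∧
        P ~[𝓝[>] 0] (fun ω : ℝ => f 0 * ((Real.log ω : ℝ) : ℂ))) ∧
    (∀ (a : ℝ) (f h : ℝ → ℂ), 0 < a → LocallyLipschitzOn (Icc 0 a) h →
      (∀ x ∈ Icc 0 a, f x = x * h x) →
      ∃ P : ℝ → ℂ, (∀ ω ∈ Ioo 0 a, HasPV f a ω (P ω)) ∧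
        ((∫ x in (0 : ℝ)..a, h x) ≠ 0 → P ~[𝓝[>] 0] (fun _ => -∫ x in (0 : ℝ)..a, h x))) ∧
    (∀ f : ℝ → ℂ, LocallyLipschitzOn (Ici 0) f → f 0 ≠ 0 →
      (∃ ω > 0, ∃ v : ℂ, HasPVTop f ω v) →
      ∃ P : ℝ → ℂ, (∀ ω > 0, HasPVTop f ω (P ω)) ∧
        P ~[𝓝[>] 0] (fun ω : ℝ => f 0 * ((Real.log ω : ℝ) : ℂ))) ∧
    (∀ f h : ℝ → ℂ, LocallyLipschitzOn (Ici 0) h → (∀ x ∈ Ici (0 : ℝ), f x = x * h x) →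
      (∃ ω > 0, ∃ v : ℂ, HasPVTop f ω v) →
      ∃ (P : ℝ → ℂ) (L : ℂ), (∀ ω > 0, HasPVTop f ω (P ω)) ∧
        Tendsto (fun b : ℝ => ∫ x in (0 : ℝ)..b, h x) atTop (𝓝 L) ∧
        (L ≠ 0 → P ~[𝓝[>] 0] (fun _ => -L))) :=
  ⟨fun _ _ => exists_hasPV_isEquivalent_mul_log,
    fun _ _ _ => exists_hasPV_isEquivalent_neg_integral,
    fun _ => exists_hasPVTop_isEquivalent_mul_log,
    fun _ _ => exists_hasPVTop_isEquivalent_neg_integral⟩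

end LocallyLipschitz

section ComplexAnalytic

variable {f g : ℝ → ℂ} {s : Set ℝ}

lemma ComplexAnalyticIn.contDiffOn (hf : ComplexAnalyticIn f s) {n : WithTop ℕ∞} :
    ContDiffOn ℝ n f s := by
  obtain ⟨F, hF, hfF⟩ := hf
  refine ContDiffOn.congr (f := fun x : ℝ => F x) (fun x hx => ?_) hfF
  have hFx : ContDiffAt ℝ n F x := (hF x (mem_image_of_mem _ hx)).contDiffAt.restrict_scalars ℝ
  exact (hFx.comp x Complex.ofRealCLM.contDiff.contDiffAt).contDiffWithinAt

lemma ComplexAnalyticIn.locallyLipschitzOn (hf : ComplexAnalyticIn f s) (hs : Convex ℝ s) :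
    LocallyLipschitzOn s f :=
  hf.contDiffOn.locallyLipschitzOn hs

lemma ComplexAnalyticIn.pow_mul (hg : ComplexAnalyticIn g s) (n : ℕ) :
    ComplexAnalyticIn (fun x => (x : ℂ) ^ n * g x) s := by
  obtain ⟨G, hG, hgG⟩ := hg
  exact ⟨fun z => z ^ n * G z, (analyticOnNhd_id.pow n).mul hG, fun x hx => by simp only [hgG x hx]⟩

end ComplexAnalytic

theorem corollary3p1 :
    -- finite `a`, `f 0 ≠ 0`
    (∀ (a : ℝ) (f : ℝ → ℂ), 0 < a → ComplexAnalyticIn f (Icc 0 a) → f 0 ≠ 0 →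
      ∃ P : ℝ → ℂ, (∀ ω ∈ Ioo 0 a, HasPV f a ω (P ω)) ∧
        P ~[𝓝[>] 0] (fun ω : ℝ => f 0 * ((Real.log ω : ℝ) : ℂ))) ∧
    -- finite `a`, `f = x ^ m * g` with a zero of order `m ≥ 1` at the origin
    (∀ (a : ℝ) (m : ℕ) (f g : ℝ → ℂ), 0 < a → 1 ≤ m → ComplexAnalyticIn g (Icc 0 a) → g 0 ≠ 0 →
      (∀ x ∈ Icc 0 a, f x = (x : ℂ) ^ m * g x) →
      ∃ P : ℝ → ℂ, (∀ ω ∈ Ioo 0 a, HasPV f a ω (P ω)) ∧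
        ((∫ x in (0 : ℝ)..a, (x : ℂ) ^ (m - 1) * g x) ≠ 0 →
          P ~[𝓝[>] 0] (fun _ : ℝ => -∫ x in (0 : ℝ)..a, (x : ℂ) ^ (m - 1) * g x))) ∧
    -- `a = ∞`, `f 0 ≠ 0`
    (∀ f : ℝ → ℂ, ComplexAnalyticIn f (Ici 0) → f 0 ≠ 0 →
      (∃ ω > 0, ∃ v : ℂ, HasPVTop f ω v) →
      ∃ P : ℝ → ℂ, (∀ ω > 0, HasPVTop f ω (P ω)) ∧
        P ~[𝓝[>] 0] (fun ω : ℝ => f 0 * ((Real.log ω : ℝ) : ℂ))) ∧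
    -- `a = ∞`, `f = x ^ m * g` with a zero of order `m ≥ 1` at the origin;
    -- `L` is the (improper) integral of `x ^ (m - 1) * g x` over `[0, ∞)`
    (∀ (m : ℕ) (f g : ℝ → ℂ), 1 ≤ m → ComplexAnalyticIn g (Ici 0) → g 0 ≠ 0 →
      (∀ x ∈ Ici (0 : ℝ), f x = (x : ℂ) ^ m * g x) →
      (∃ ω > 0, ∃ v : ℂ, HasPVTop f ω v) →
      ∃ (P : ℝ → ℂ) (L : ℂ), (∀ ω > 0, HasPVTop f ω (P ω)) ∧
        Tendsto (fun b : ℝ => ∫ x in (0 : ℝ)..b, (x : ℂ) ^ (m - 1) * g x) atTop (𝓝 L) ∧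
        (L ≠ 0 → P ~[𝓝[>] 0] (fun _ : ℝ => -L))) :=
  have hpow {m : ℕ} (hm : 1 ≤ m) (x z : ℂ) : x ^ m * z = x * (x ^ (m - 1) * z) := by
    rw [← mul_assoc, mul_pow_sub_one (by omega)]
  have ⟨hlog, hzero, hlogTop, hzeroTop⟩ := corollary3p1_general
  ⟨fun a f ha hf => hlog a f ha (hf.locallyLipschitzOn (convex_Icc 0 a)),
    fun a m f _ ha hm hg _ hfg => hzero a f _ ha
      ((hg.pow_mul (m - 1)).locallyLipschitzOn (convex_Icc 0 a))
      fun x hx => (hfg x hx).trans (hpow hm x _),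
    fun f hf => hlogTop f (hf.locallyLipschitzOn (convex_Ici 0)),
    fun m f _ hm hg _ hfg => hzeroTop f _
      ((hg.pow_mul (m - 1)).locallyLipschitzOn (convex_Ici 0))
      fun x hx => (hfg x hx).trans (hpow hm x _)⟩
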